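/- Let $S$ be a finite set of pairwise disjoint closed line segments in the Euclidean plane $\mathbb{R}^2$ (segments may degenerate to points), in general position: for every point $x$ and every $r>0$ at most three segments $s\in S$ satisfy $d(x,s)=r$ (at most three sites touch the same circle), and no three distinct endpoints of segments of $S$ lie on a common line. Here $d(x,s)=\min_{q\in s}\|x-q\|$. Let $k\ge 1$ and let $H\subseteq S$ with $|H|=k$. The order-$k$ Voronoi region of $H$ is $$V_k(H,S)=\{x\in\mathbb{R}^2 : d(x,s)<d(x,t)\ \text{ for all } s\in H,\ t\in S\setminus H\},$$ which is an open set, and its faces are its connected components. A supporting halfplane of $s,t\in S$ and $H'\subseteq S$, where $s,t\notin H'$, is an open halfplane $h$ whose boundary line passes through an endpoint of $s$ and an endpoint of $t$, such that $h$ intersects every segment in $H'$ and no segment in $S\setminus H'$. For an endpoint $p$ of a segment $s\in H$, a supporting halfplane induced by $p$ is a supporting halfplane of $s$, $t$ and $H\setminus\{s\}$, for some $t\in S\setminus H$, whose boundary line passes through $p$. A Voronoi edge separating $V_k(H,S)$ from $V_k((H\setminus\{s\})\cup\{t\},S)$, where $s\in H$ and $t\in S\setminus H$, is a connected component of the set of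 points $x$ with $d(x,s)=d(x,t)$, $d(x,s')<d(x,s)$ for all $s'\in H\setminus\{s\}$, and $d(x,s)<d(x,t')$ for all $t'\in S\setminus (H\cup\{t\})$. Such an edge is an unbounded edge induced by the endpoint $p$ of $s$ if the set of its points $x$ with $d(x,s)=\|x-p\|$ is unbounded. Then the following hold. 1. The region $V_k(H,S)$ has $O(k)$ unbounded faces: there is an absolute constant $C$, independent of $S$, $H$ and $k$, such that the number of unbounded faces of $V_k(H,S)$ is at most $Ck$. 2. Every endpoint $p$ of every segment $s\in H$ induces at most two supporting halfplanes, and at most two unbounded Voronoi edges bordering $V_k(H,S)$. -/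

import Mathlib

open scoped RealInnerProductSpace

namespace SegmentVoronoi

/-- The Euclidean plane. -/
abbrev Plane : Type := EuclideanSpace ℝ (Fin 2)

/-- A closed line segment, given by its two endpoints; it may degenerate to a point. -/
structure LineSegment where
  left : Plane
  right : Plane

/-- The points of a line segment. -/
def LineSegment.carrier (s : LineSegment) : Set Plane :=
  segment ℝ s.left s.right

/-- The endpoints of a line segment. -/
def LineSegment.endpoints (s : LineSegment) : Set Plane :=
  {s.left, s.right}

/-- The distance of a point to a line segment; the infimum is attained because segments are
nonempty and compact. -/
noncomputable def segDist (x : Plane) (s : LineSegment) : ℝ :=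
  Metric.infDist x s.carrier

/-- General position: at most three sites touch the same circle, and at most two endpoints
lie on the same line. The circle of radius `r` about `x` is touched by `s` when `s` meets the
closed disk but not the open disk, that is, when the distance of `x` to `s` is `r`. -/
structure GeneralPosition (S : Set LineSegment) : Prop where
  circle : ∀ (x : Plane) (r : ℝ), 0 < r → {s ∈ S | segDist x s = r}.encard ≤ 3
  line : ∀ T : Set Plane, T ⊆ ⋃ s ∈ S, s.endpoints → Collinear ℝ T → T.encard ≤ 2

/-- The generalized Voronoi region of `H`: the points that are closer to every segment in `H`
than to every segment of `S` outside `H`. It is an order-`k` region when `H` has `k` elements. -/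
def voronoiRegion (S H : Set LineSegment) : Set Plane :=
  {x | ∀ s ∈ H, ∀ t ∈ S \ H, segDist x s < segDist x t}

/-- A face of a region: a maximal connected subset of its interior
(the regions `voronoiRegion S H` of finite `S` are open). -/
def IsFace (R F : Set Plane) : Prop :=
  Maximal (fun A : Set Plane => A ⊆ interior R ∧ IsConnected A) F

/-- An open halfplane. -/
def IsOpenHalfplane (h : Set Plane) : Prop :=
  ∃ u : Plane, u ≠ 0 ∧ ∃ c : ℝ, h = {x | c < ⟪u, x⟫}

/-- `h` is a supporting halfplane of `s₁`, `s₂` and `H`: an open halfplane whose boundary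
passes through an endpoint of `s₁` and an endpoint of `s₂`, and which intersects all segments
in `H` and no segment in `S \ H`. -/
structure IsSupportingHalfplane (S H : Set LineSegment) (s₁ s₂ : LineSegment)
    (h : Set Plane) : Prop where
  subset : H ⊆ S
  left_mem : s₁ ∈ S \ H
  right_mem : s₂ ∈ S \ H
  halfplane : IsOpenHalfplane h
  left_boundary : (s₁.endpoints ∩ frontier h).Nonempty
  right_boundary : (s₂.endpoints ∩ frontier h).Nonempty
  meets : ∀ s ∈ H, (s.carrier ∩ h).Nonempty
  avoids : ∀ s ∈ S \ H, Disjoint s.carrier h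

/-- The points at which the regions of `H ∪ {s₁}` and `H ∪ {s₂}` border each other: the points
equidistant from `s₁` and `s₂`, closer to all segments in `H`, and farther from all other
segments of `S`. Voronoi vertices, where a third segment is at the same distance, do not
belong to it. -/
def edgeLocus (S H : Set LineSegment) (s₁ s₂ : LineSegment) : Set Plane :=
  {x | segDist x s₁ = segDist x s₂ ∧ (∀ s ∈ H, segDist x s < segDist x s₁) ∧
    ∀ s ∈ S \ (H ∪ {s₁, s₂}), segDist x s₁ < segDist x s}

/-- A Voronoi edge (without its end vertices) separating the regions of `H ∪ {s₁}` and
`H ∪ {s₂}`: a maximal connected subset of their edge locus. -/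
def IsVoronoiEdge (S H : Set LineSegment) (s₁ s₂ : LineSegment) (E : Set Plane) : Prop :=
  Maximal (fun A : Set Plane => A ⊆ edgeLocus S H s₁ s₂ ∧ IsConnected A) E

/-- The supporting halfplanes induced by an endpoint `p` of a segment `s ∈ H`: the supporting
halfplanes of `s`, `t` and `H \ {s}`, for some `t ∈ S \ H`, whose boundary passes
through `p`. -/
def inducedHalfplanes (S H : Set LineSegment) (s : LineSegment) (p : Plane) :
    Set (Set Plane) :=
  {h | p ∈ frontier h ∧ ∃ t ∈ S \ H, IsSupportingHalfplane S (H \ {s}) s t h}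

/-- The unbounded Voronoi edges bordering the region of `H` that are induced by an endpoint `p`
of a segment `s ∈ H`: those separating it from the region of `(H \ {s}) ∪ {t}`, for some
`t ∈ S \ H`, and having points arbitrarily far away whose nearest point on `s` is `p`. -/
def inducedUnboundedEdges (S H : Set LineSegment) (s : LineSegment) (p : Plane) :
    Set (Set Plane) :=
  {E | (∃ t ∈ S \ H, IsVoronoiEdge S (H \ {s}) s t E) ∧
    ¬ Bornology.IsBounded {x ∈ E | dist x p = segDist x s}}

end SegmentVoronoi

namespace SegmentVoronoi

/-! Everything is read off at infinity. As `x` escapes in a unit direction `u`, `‖x‖ - segDist x s`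
tends to the support function of `s` at `u` (`tendsto_norm_sub_segDist`), so far away the nearer
segments are those with larger support. If the region of `H` accumulates in direction `u`, no
segment outside `H` has larger support there than one of `H`. If all these inequalities are strict,
the region contains a whole convex sector about `u`. If one is an equality, `u` is a supporting
normal at an endpoint of a segment of `H`. General position then leaves only one pair `s`, `t`
competing near `u`, each represented by a single endpoint, so in a sector the region is a halfplane
and the edge locus a line. Hence each normal carries at most one unbounded face and one unbounded
edge.

For a fixed endpoint `p`, the normals are orthogonal to supporting lines at the apex of a planar
cone, so there are at most two (`exists_eq_of_three_supporting`). This bounds the halfplanes and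
edges at `p`, and gives at most `4k` normals in all. Faces accumulating at normals are charged to
them injectively. A face avoiding all normals fills every direction, since the circle is connected,
and is then the only unbounded face. -/

open Filter Topology Bornology

/-! ### Escaping to infinity in a given direction -/

/-- The filter of neighbourhoods of the point at infinity in direction `u`. -/
noncomputable def atInfinity (u : Plane) : Filter Plane :=
  comap (fun x => ‖x‖⁻¹ • x) (𝓝 u) ⊓ cobounded Plane

theorem tendsto_normalize (u : Plane) :
    Tendsto (fun x : Plane => ‖x‖⁻¹ • x) (atInfinity u) (𝓝 u) :=
  tendsto_comap.mono_left inf_le_left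

theorem tendsto_norm_atInfinity (u : Plane) :
    Tendsto (fun x : Plane => ‖x‖) (atInfinity u) atTop :=
  tendsto_norm_cobounded_atTop.mono_left inf_le_right

theorem tendsto_inner_normalize (u q : Plane) :
    Tendsto (fun x : Plane => ⟪‖x‖⁻¹ • x, q⟫) (atInfinity u) (𝓝 ⟪u, q⟫) :=
  (tendsto_normalize u).inner tendsto_const_nhds

theorem eventually_norm_pos (u : Plane) : ∀ᶠ x in atInfinity u, 0 < ‖x‖ :=
  (tendsto_norm_atInfinity u).eventually_gt_atTop 0

/-- Compactness of the unit circle: the normalized points of `A`, taken along the cobounded filter,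
have a cluster point. -/
theorem exists_direction {A : Set Plane} (hA : ¬ IsBounded A) :
    ∃ u : Plane, ‖u‖ = 1 ∧ ∃ᶠ x in atInfinity u, x ∈ A := by
  have hne : (cobounded Plane ⊓ 𝓟 A).NeBot := by
    rw [← frequently_mem_iff_neBot]
    intro h
    exact hA (isBounded_def.2 h)
  have hle : map (fun x : Plane => ‖x‖⁻¹ • x) (cobounded Plane ⊓ 𝓟 A) ≤
      𝓟 (Metric.sphere (0 : Plane) 1) := by
    rw [le_principal_iff, mem_map]
    have h0 : ∀ᶠ x : Plane in cobounded Plane, 0 < ‖x‖ :=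
      tendsto_norm_cobounded_atTop.eventually_gt_atTop 0
    filter_upwards [h0.filter_mono inf_le_left] with x hx
    simp [norm_smul, hx.ne']
  obtain ⟨u, hu, hcl⟩ := (isCompact_sphere (0 : Plane) 1) hle
  refine ⟨u, by simpa using hu, ?_⟩
  rw [frequently_mem_iff_neBot, atInfinity, inf_assoc]
  rw [ClusterPt, inf_comm, ← Filter.push_pull, inf_comm] at hcl
  exact map_neBot_iff _ |>.1 hcl

theorem isClosed_setOf_frequently_atInfinity (A : Set Plane) :
    IsClosed {u : Plane | ∃ᶠ x in atInfinity u, x ∈ A} := by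
  have : {u : Plane | ∃ᶠ x in atInfinity u, x ∈ A} =
      {u | ClusterPt u (map (fun x : Plane => ‖x‖⁻¹ • x) (cobounded Plane ⊓ 𝓟 A))} := by
    ext u
    rw [Set.mem_ofPred_eq, Set.mem_ofPred_eq, frequently_mem_iff_neBot, atInfinity, inf_assoc,
      ClusterPt, inf_comm (𝓝 u), ← Filter.push_pull, inf_comm (comap _ _), map_neBot_iff]
  rw [this]
  exact isClosed_setOfPred_clusterPt

theorem atInfinity_neBot {u : Plane} (hu : ‖u‖ = 1) : (atInfinity u).NeBot := by
  have h : Tendsto (fun r : ℝ => r • u) atTop (atInfinity u) := by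
    refine tendsto_inf.2 ⟨tendsto_comap_iff.2 ?_, ?_⟩
    · refine tendsto_const_nhds.congr' ?_
      filter_upwards [eventually_gt_atTop 0] with r hr
      simp [norm_smul, hu, smul_smul, abs_of_pos hr, hr.ne']
    · rw [← tendsto_norm_atTop_iff_cobounded]
      simpa [norm_smul, hu] using tendsto_abs_atTop_atTop
  exact h.neBot

theorem eventually_atInfinity_nhds {u : Plane} {A : Set Plane} (h : A ∈ atInfinity u) :
    ∀ᶠ v in 𝓝 u, A ∈ atInfinity v := by
  obtain ⟨B, hB, D, hD, rfl⟩ := mem_inf_iff.1 h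
  obtain ⟨V, hV, hVB⟩ := mem_comap.1 hB
  filter_upwards [eventually_mem_nhds_iff.2 hV] with v hv
  exact mem_inf_of_inter (mem_comap.2 ⟨V, hv, hVB⟩) hD subset_rfl

/-- The convex sectors about the ray in direction `u`. -/
def sector (u : Plane) (R ε : ℝ) : Set Plane :=
  {x | R < ⟪u, x⟫ ∧ ‖x - ⟪u, x⟫ • u‖ < ε * ⟪u, x⟫}

theorem convex_sector (u : Plane) (R ε : ℝ) : Convex ℝ (sector u R ε) := by
  rintro x ⟨hx, hx'⟩ y ⟨hy, hy'⟩ a b ha hb hab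
  have hin : ⟪u, a • x + b • y⟫ = a * ⟪u, x⟫ + b * ⟪u, y⟫ := by
    simp [inner_add_right, inner_smul_right]
  have hpos : 0 < a ∨ 0 < b := by
    by_contra! h
    linarith
  have hcomb : ∀ r r' t t' : ℝ, r < t → r' < t' → a * r + b * r' < a * t + b * t' := by
    intro r r' t t' h h'
    rcases hpos with h0 | h0
    · exact add_lt_add_of_lt_of_le (mul_lt_mul_of_pos_left h h0)
        (mul_le_mul_of_nonneg_left h'.le hb)
    · exact add_lt_add_of_le_of_lt (mul_le_mul_of_nonneg_left h.le ha)
        (mul_lt_mul_of_pos_left h' h0)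
  refine ⟨?_, ?_⟩
  · have := hcomb R R _ _ hx hy
    rw [hin]
    rwa [← add_mul, hab, one_mul] at this
  · have heq : a • x + b • y - ⟪u, a • x + b • y⟫ • u =
        a • (x - ⟪u, x⟫ • u) + b • (y - ⟪u, y⟫ • u) := by
      rw [hin]
      module
    calc ‖a • x + b • y - ⟪u, a • x + b • y⟫ • u‖
        ≤ a * ‖x - ⟪u, x⟫ • u‖ + b * ‖y - ⟪u, y⟫ • u‖ := by
          rw [heq]
          refine (norm_add_le _ _).trans_eq ?_
          rw [norm_smul, norm_smul, Real.norm_of_nonneg ha, Real.norm_of_nonneg hb]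
      _ < a * (ε * ⟪u, x⟫) + b * (ε * ⟪u, y⟫) := hcomb _ _ _ _ hx' hy'
      _ = ε * ⟪u, a • x + b • y⟫ := by rw [hin]; ring

theorem sector_mem_atInfinity {u : Plane} (hu : ‖u‖ = 1) (R : ℝ) {ε : ℝ} (hε : 0 < ε) :
    sector u R ε ∈ atInfinity u := by
  have hin : Tendsto (fun x : Plane => ⟪u, ‖x‖⁻¹ • x⟫) (atInfinity u) (𝓝 1) := by
    have := (tendsto_const_nhds (x := u)).inner (𝕜 := ℝ) (tendsto_normalize u)
    rwa [real_inner_self_eq_norm_sq, hu, one_pow] at this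
  have h1 : ∀ᶠ x in atInfinity u, R < ⟪u, x⟫ := by
    have := (tendsto_norm_atInfinity u).atTop_mul_pos one_pos hin
    filter_upwards [this.eventually_gt_atTop R, eventually_norm_pos u] with x hx hx0
    rwa [inner_smul_right, mul_inv_cancel_left₀ hx0.ne'] at hx
  have h2 : ∀ᶠ x in atInfinity u,
      ‖‖x‖⁻¹ • x - ⟪u, ‖x‖⁻¹ • x⟫ • u‖ < ε * ⟪u, ‖x‖⁻¹ • x⟫ := by
    have hl := ((tendsto_normalize u).sub (hin.smul_const u)).norm
    have hr := hin.const_mul ε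
    refine hl.eventually_lt hr ?_
    simpa using hε
  filter_upwards [h1, h2, eventually_norm_pos u] with x hx hx' hx0
  refine ⟨hx, ?_⟩
  have heq : x - ⟪u, x⟫ • u = ‖x‖ • (‖x‖⁻¹ • x - ⟪u, ‖x‖⁻¹ • x⟫ • u) := by
    rw [inner_smul_right, smul_sub, smul_smul, smul_smul, mul_inv_cancel₀ hx0.ne',
      mul_inv_cancel_left₀ hx0.ne', one_smul]
  rw [heq, norm_smul, norm_norm]
  calc ‖x‖ * _ < ‖x‖ * (ε * ⟪u, ‖x‖⁻¹ • x⟫) := mul_lt_mul_of_pos_left hx' hx0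
    _ = ε * ⟪u, x⟫ := by
      rw [inner_smul_right, mul_left_comm, mul_inv_cancel_left₀ hx0.ne']

/-- Sectors form a convex base of neighbourhoods of the point at infinity. Convexity is what later
yields connectedness. -/
theorem exists_convex_of_eventually {u : Plane} (hu : ‖u‖ = 1) {P : Plane → Prop}
    (h : ∀ᶠ x in atInfinity u, P x) :
    ∃ C ∈ atInfinity u, Convex ℝ C ∧ ∀ x ∈ C, P x := by
  obtain ⟨B, hB, D, hD, hBD⟩ := mem_inf_iff_superset.1 h
  obtain ⟨V, hV, hVB⟩ := mem_comap.1 hB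
  obtain ⟨δ, hδ, hδV⟩ := Metric.mem_nhds_iff.1 hV
  obtain ⟨R, -, hR⟩ := (hasBasis_cobounded_norm (E := Plane)).mem_iff.1 hD
  -- In the sector, `x` differs from `‖x‖ • u` by at most twice its component orthogonal to `u`,
  -- hence by less than `2 * (δ / 3) * ‖x‖`.
  have hδ3 : 0 < δ / 3 := by positivity
  refine ⟨sector u (max R 0) (δ / 3), sector_mem_atInfinity hu _ hδ3, convex_sector _ _ _, ?_⟩
  rintro x ⟨hx, hx'⟩
  have ha : 0 < ⟪u, x⟫ := (le_max_right _ _).trans_lt hx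
  have hn : ⟪u, x⟫ ≤ ‖x‖ := by simpa [hu] using real_inner_le_norm u x
  have hn0 : 0 < ‖x‖ := ha.trans_le hn
  have hn' : ‖x‖ ≤ ⟪u, x⟫ + ‖x - ⟪u, x⟫ • u‖ := by
    have := norm_add_le (⟪u, x⟫ • u) (x - ⟪u, x⟫ • u)
    rwa [add_sub_cancel, norm_smul, hu, mul_one, Real.norm_of_nonneg ha.le] at this
  refine hBD ⟨hVB (hδV ?_), hR ?_⟩
  · have heq : ‖x‖⁻¹ • x - u =
        ‖x‖⁻¹ • ((x - ⟪u, x⟫ • u) + (⟪u, x⟫ - ‖x‖) • u) := by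
      rw [sub_smul, sub_add_sub_cancel, smul_sub, smul_smul, inv_mul_cancel₀ hn0.ne', one_smul]
    have hle : ‖(x - ⟪u, x⟫ • u) + (⟪u, x⟫ - ‖x‖) • u‖ < ‖x‖ * δ := by
      refine (norm_add_le _ _).trans_lt ?_
      rw [norm_smul, hu, mul_one, Real.norm_of_nonpos (by linarith)]
      nlinarith
    rw [Metric.mem_ball, dist_eq_norm, heq, norm_smul, norm_inv, norm_norm,
      inv_mul_lt_iff₀ hn0]
    exact hle
  · exact ((le_max_left _ _).trans hx.le).trans hn

/-! ### Distances to segments near infinity -/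

/-- The support function of a segment. -/
noncomputable def LineSegment.support (s : LineSegment) (u : Plane) : ℝ :=
  max ⟪u, s.left⟫ ⟪u, s.right⟫

theorem LineSegment.inner_le_support {s : LineSegment} {p : Plane} (hp : p ∈ s.endpoints)
    (u : Plane) : ⟪u, p⟫ ≤ s.support u := by
  rcases hp with rfl | rfl
  · exact le_max_left _ _
  · exact le_max_right _ _

theorem LineSegment.exists_endpoint (s : LineSegment) (u : Plane) :
    ∃ p ∈ s.endpoints, ⟪u, p⟫ = s.support u := by
  rcases max_choice ⟪u, s.left⟫ ⟪u, s.right⟫ with h | h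
  · exact ⟨s.left, Or.inl rfl, h.symm⟩
  · exact ⟨s.right, Or.inr rfl, h.symm⟩

theorem LineSegment.inner_le_support_of_mem {s : LineSegment} {x : Plane} (hx : x ∈ s.carrier)
    (u : Plane) : ⟪u, x⟫ ≤ s.support u := by
  obtain ⟨a, b, ha, hb, hab, rfl⟩ := hx
  rw [inner_add_right, inner_smul_right, inner_smul_right]
  calc a * ⟪u, s.left⟫ + b * ⟪u, s.right⟫ ≤ a * s.support u + b * s.support u :=
        add_le_add (mul_le_mul_of_nonneg_left (le_max_left _ _) ha)
          (mul_le_mul_of_nonneg_left (le_max_right _ _) hb)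
    _ = s.support u := by rw [← add_mul, hab, one_mul]

theorem LineSegment.endpoints_subset (s : LineSegment) : s.endpoints ⊆ s.carrier := by
  rintro p (rfl | rfl)
  · exact left_mem_segment ℝ _ _
  · exact right_mem_segment ℝ _ _

theorem segDist_le_dist {s : LineSegment} {p : Plane} (hp : p ∈ s.endpoints) (x : Plane) :
    segDist x s ≤ dist x p :=
  Metric.infDist_le_dist_of_mem (s.endpoints_subset hp)

theorem continuous_segDist (s : LineSegment) : Continuous fun x => segDist x s :=
  Metric.continuous_infDist_pt _

theorem le_segDist {s : LineSegment} {x : Plane} {r : ℝ} :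
    r ≤ segDist x s ↔ ∀ q ∈ s.carrier, r ≤ dist x q :=
  Metric.le_infDist ⟨s.left, left_mem_segment ℝ _ _⟩

theorem norm_sub_dist_le {x : Plane} (hx : 0 < ‖x‖) (q : Plane) :
    ‖x‖ - dist x q ≤ ⟪‖x‖⁻¹ • x, q⟫ := by
  have h := real_inner_le_norm (‖x‖⁻¹ • x) (x - q)
  have h1 : ‖‖x‖⁻¹ • x‖ = 1 := by simp [norm_smul, hx.ne']
  have h2 : ⟪‖x‖⁻¹ • x, x⟫ = ‖x‖ := by
    rw [real_inner_smul_left, real_inner_self_eq_norm_mul_norm, inv_mul_cancel_left₀ hx.ne']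
  rw [h1, one_mul, inner_sub_right, h2, ← dist_eq_norm] at h
  linarith

/-- Rationalize: the difference is `(2 * ⟪x, q⟫ - ‖q‖ ^ 2) / (‖x‖ + dist x q)`. Dividing through by
`‖x‖` makes the denominator tend to 2. -/
theorem tendsto_norm_sub_dist (u q : Plane) :
    Tendsto (fun x : Plane => ‖x‖ - dist x q) (atInfinity u) (𝓝 ⟪u, q⟫) := by
  have hinv : Tendsto (fun x : Plane => ‖x‖⁻¹) (atInfinity u) (𝓝 0) :=
    (tendsto_norm_atInfinity u).inv_tendsto_atTop
  have hratio : Tendsto (fun x : Plane => dist x q * ‖x‖⁻¹) (atInfinity u) (𝓝 1) := by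
    have hlo : Tendsto (fun x : Plane => 1 - ‖q‖ * ‖x‖⁻¹) (atInfinity u) (𝓝 1) := by
      simpa using (hinv.const_mul ‖q‖).const_sub 1
    have hhi : Tendsto (fun x : Plane => 1 + ‖q‖ * ‖x‖⁻¹) (atInfinity u) (𝓝 1) := by
      simpa using (hinv.const_mul ‖q‖).const_add 1
    refine tendsto_of_tendsto_of_tendsto_of_le_of_le' hlo hhi ?_ ?_
    · filter_upwards [eventually_norm_pos u] with x hx
      have : ‖x‖ - ‖q‖ ≤ dist x q := by rw [dist_eq_norm]; exact norm_sub_norm_le x q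
      calc 1 - ‖q‖ * ‖x‖⁻¹ = (‖x‖ - ‖q‖) * ‖x‖⁻¹ := by field_simp
        _ ≤ _ := mul_le_mul_of_nonneg_right this (inv_nonneg.2 hx.le)
    · filter_upwards [eventually_norm_pos u] with x hx
      have : dist x q ≤ ‖x‖ + ‖q‖ := by rw [dist_eq_norm]; exact norm_sub_le x q
      calc _ ≤ (‖x‖ + ‖q‖) * ‖x‖⁻¹ := mul_le_mul_of_nonneg_right this (inv_nonneg.2 hx.le)
        _ = 1 + ‖q‖ * ‖x‖⁻¹ := by field_simp
  have hnum : Tendsto (fun x : Plane => 2 * ⟪‖x‖⁻¹ • x, q⟫ - ‖q‖ ^ 2 * ‖x‖⁻¹) (atInfinity u)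
      (𝓝 (2 * ⟪u, q⟫ - ‖q‖ ^ 2 * 0)) :=
    ((tendsto_inner_normalize u q).const_mul 2).sub (hinv.const_mul _)
  have hquot := hnum.div (hratio.const_add 1) (by norm_num)
  have hlim : (2 * ⟪u, q⟫ - ‖q‖ ^ 2 * 0) / (1 + 1) = ⟪u, q⟫ := by ring
  rw [hlim] at hquot
  refine hquot.congr' ?_
  filter_upwards [eventually_norm_pos u] with x hx
  have hsq : dist x q ^ 2 = ‖x‖ ^ 2 - 2 * ⟪x, q⟫ + ‖q‖ ^ 2 := by
    rw [dist_eq_norm, norm_sub_sq_real]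
  have hd : 0 ≤ dist x q := dist_nonneg
  rw [Pi.div_apply, real_inner_smul_left, div_eq_iff (by positivity)]
  field_simp
  linear_combination hsq

/-- A squeeze that never locates the nearest point: the endpoints bound the distance from above, and
Cauchy–Schwarz at every point of the segment bounds it from below. -/
theorem tendsto_norm_sub_segDist (u : Plane) (s : LineSegment) :
    Tendsto (fun x : Plane => ‖x‖ - segDist x s) (atInfinity u) (𝓝 (s.support u)) := by
  refine tendsto_of_tendsto_of_tendsto_of_le_of_le'
    ((tendsto_norm_sub_dist u s.left).max (tendsto_norm_sub_dist u s.right))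
    ((tendsto_inner_normalize u s.left).max (tendsto_inner_normalize u s.right)) ?_ ?_
  · refine Eventually.of_forall fun x => max_le ?_ ?_
    · exact sub_le_sub_left (segDist_le_dist (Or.inl rfl) x) _
    · exact sub_le_sub_left (segDist_le_dist (Or.inr rfl) x) _
  · filter_upwards [eventually_norm_pos u] with x hx
    rw [sub_le_comm, le_segDist]
    intro q hq
    have h1 := norm_sub_dist_le hx q
    have h2 := s.inner_le_support_of_mem hq (‖x‖⁻¹ • x)
    rw [LineSegment.support] at h2
    linarith

theorem eventually_segDist_lt {u : Plane} {s t : LineSegment}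
    (h : t.support u < s.support u) : ∀ᶠ x in atInfinity u, segDist x s < segDist x t := by
  filter_upwards [(tendsto_norm_sub_segDist u t).eventually_lt (tendsto_norm_sub_segDist u s) h]
    with x hx
  linarith

theorem support_le_of_frequently {u : Plane} {s t : LineSegment}
    (h : ∃ᶠ x in atInfinity u, segDist x s ≤ segDist x t) : t.support u ≤ s.support u := by
  by_contra! hlt
  exact h ((eventually_segDist_lt hlt).mono fun x hx => hx.not_ge)

theorem support_eq_of_frequently {u p : Plane} {s : LineSegment} (hp : p ∈ s.endpoints)
    (h : ∃ᶠ x in atInfinity u, dist x p = segDist x s) : s.support u = ⟪u, p⟫ := by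
  refine le_antisymm ?_ (s.inner_le_support hp u)
  by_contra! hlt
  refine h ?_
  filter_upwards [(tendsto_norm_sub_dist u p).eventually_lt (tendsto_norm_sub_segDist u s) hlt]
    with x hx hxe
  linarith

theorem dist_le_dist_of_inner_nonpos {x p q y : Plane} (h : ⟪x - p, q - p⟫ ≤ 0)
    (hy : y ∈ segment ℝ p q) : dist x p ≤ dist x y := by
  rw [segment_eq_image'] at hy
  obtain ⟨a, ⟨ha, -⟩, rfl⟩ := hy
  rw [dist_eq_norm, dist_eq_norm, ← sub_sub]
  refine (sq_le_sq₀ (norm_nonneg _) (norm_nonneg _)).1 ?_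
  rw [norm_sub_sq_real (x - p), inner_smul_right]
  nlinarith [mul_nonneg ha (neg_nonneg.2 h), sq_nonneg ‖a • (q - p)‖]

theorem LineSegment.exists_other_endpoint {s : LineSegment} {p : Plane} (hp : p ∈ s.endpoints) :
    ∃ q ∈ s.endpoints, s.carrier = segment ℝ p q := by
  rcases hp with rfl | rfl
  · exact ⟨s.right, Or.inr rfl, rfl⟩
  · exact ⟨s.left, Or.inl rfl, segment_symm ℝ _ _⟩

/-- When `p` is the strict maximizer of `⟪u, ·⟫` on `s`, the angle at `p` between `x` and the other
endpoint is eventually obtuse, so `p` is the nearest point. -/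
theorem eventually_segDist_eq_dist {u p : Plane} {s : LineSegment} (hp : p ∈ s.endpoints)
    (h : ∀ q ∈ s.endpoints, q ≠ p → ⟪u, q⟫ < ⟪u, p⟫) :
    ∀ᶠ x in atInfinity u, segDist x s = dist x p := by
  obtain ⟨q, hq, hs⟩ := s.exists_other_endpoint hp
  suffices ∀ᶠ x in atInfinity u, ⟪x - p, q - p⟫ ≤ 0 by
    filter_upwards [this] with x hx
    refine le_antisymm (segDist_le_dist hp x) (le_segDist.2 fun y hy => ?_)
    exact dist_le_dist_of_inner_nonpos hx (hs ▸ hy)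
  by_cases hqp : q = p
  · simp [hqp]
  have hinv : Tendsto (fun x : Plane => ‖x‖⁻¹) (atInfinity u) (𝓝 0) :=
    (tendsto_norm_atInfinity u).inv_tendsto_atTop
  have hlim : Tendsto (fun x : Plane => ⟪‖x‖⁻¹ • x, q - p⟫ - ‖x‖⁻¹ * ⟪p, q - p⟫)
      (atInfinity u) (𝓝 (⟪u, q - p⟫ - 0 * ⟪p, q - p⟫)) :=
    (tendsto_inner_normalize u (q - p)).sub (hinv.mul_const _)
  have hneg : ⟪u, q - p⟫ - 0 * ⟪p, q - p⟫ < 0 := by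
    rw [inner_sub_right]
    linarith [h q hq hqp]
  filter_upwards [hlim.eventually_lt_const hneg, eventually_norm_pos u] with x hx hx0
  rw [real_inner_smul_left, ← mul_sub, ← inner_sub_left] at hx
  exact (neg_of_mul_neg_right hx (inv_nonneg.2 hx0.le)).le

/-! ### Supporting normals -/

theorem inner_eq_coord (x y : Plane) : ⟪x, y⟫ = x 0 * y 0 + x 1 * y 1 := by
  simp [PiLp.inner_apply, Fin.sum_univ_two, mul_comm]

theorem coord_sq_add_sq {u : Plane} (hu : ‖u‖ = 1) : u 0 ^ 2 + u 1 ^ 2 = 1 := by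
  have := real_inner_self_eq_norm_sq u
  rw [hu, inner_eq_coord] at this
  linarith

/-- Lagrange's identity: the squares of the inner product and the determinant add up to 1. -/
theorem eq_or_eq_neg_of_det_eq_zero {a b : Plane} (ha : ‖a‖ = 1) (hb : ‖b‖ = 1)
    (h : a 0 * b 1 - a 1 * b 0 = 0) : a = b ∨ a = -b := by
  have hsq : (⟪a, b⟫ - 1) * (⟪a, b⟫ + 1) = 0 := by
    rw [inner_eq_coord]
    linear_combination (a 0 ^ 2 + a 1 ^ 2) * coord_sq_add_sq hb + coord_sq_add_sq ha -
      (a 0 * b 1 - a 1 * b 0) * h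
  rcases mul_eq_zero.1 hsq with h1 | h1
  · exact Or.inl ((inner_eq_one_iff_of_norm_eq_one (𝕜 := ℝ) ha hb).1 (by linarith))
  · refine Or.inr ((inner_eq_one_iff_of_norm_eq_one (𝕜 := ℝ) ha (by simpa using hb)).1 ?_)
    rw [inner_neg_right]
    linarith

theorem exists_coord_of_inner_eq_zero {u v : Plane} (hu : ‖u‖ = 1) (hv : v ≠ 0)
    (h : ⟪u, v⟫ = 0) : ∃ c : ℝ, c ≠ 0 ∧ v 0 = -c * u 1 ∧ v 1 = c * u 0 := by
  have hsq := coord_sq_add_sq hu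
  rw [inner_eq_coord] at h
  have h0 : v 0 = -(u 0 * v 1 - u 1 * v 0) * u 1 := by
    linear_combination u 0 * h - v 0 * hsq
  have h1 : v 1 = (u 0 * v 1 - u 1 * v 0) * u 0 := by
    linear_combination u 1 * h - v 1 * hsq
  refine ⟨_, fun hc => hv ?_, h0, h1⟩
  rw [hc] at h0 h1
  ext i
  fin_cases i
  · simpa using h0
  · simpa using h1

/-- A planar cone has at most two supporting lines: among three unit vectors, each orthogonal to
some member of a family of nonzero vectors on which they are all nonpositive, two coincide. -/
theorem exists_eq_of_three_supporting {u v : Fin 3 → Plane} (hu : ∀ i, ‖u i‖ = 1)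
    (hv : ∀ i, v i ≠ 0) (h0 : ∀ i, ⟪u i, v i⟫ = 0) (h : ∀ i j, ⟪u i, v j⟫ ≤ 0) :
    ∃ i j, i ≠ j ∧ u i = u j := by
  -- Each `v i` is `c i` times the quarter turn of `u i`. Two of the three signs of `c` agree.
  choose c hc hc0 hc1 using fun i => exists_coord_of_inner_eq_zero (hu i) (hv i) (h0 i)
  have hdet : ∀ i j, c j * (u i 1 * u j 0 - u i 0 * u j 1) ≤ 0 := by
    intro i j
    have := h i j
    rw [inner_eq_coord, hc0, hc1] at this
    linarith
  -- Equal signs force `u i = ± u j`, as the two inequalities bound the determinant from both sides.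
  -- If the vectors are opposite, the same argument makes `u k` parallel to both, hence equal to one
  -- of them.
  have key : ∀ i j k, i ≠ j → k ≠ i → k ≠ j → 0 < c i * c j → ∃ i j, i ≠ j ∧ u i = u j := by
    intro i j k hij hki hkj hpos
    have hd : u i 0 * u j 1 - u i 1 * u j 0 = 0 := by
      have hi := hdet j i
      have hj := hdet i j
      rcases pos_and_pos_or_neg_and_neg_of_mul_pos hpos with ⟨h1, h2⟩ | ⟨h1, h2⟩
      · have := nonpos_of_mul_nonpos_right hi h1
        have := nonpos_of_mul_nonpos_right hj h2
        linarith
      · have := nonneg_of_mul_nonpos_right hi h1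
        have := nonneg_of_mul_nonpos_right hj h2
        linarith
    rcases eq_or_eq_neg_of_det_eq_zero (hu i) (hu j) hd with he | he
    · exact ⟨i, j, hij, he⟩
    have hk : u k 0 * u i 1 - u k 1 * u i 0 = 0 := by
      have hi := hdet k i
      have hj := hdet k j
      have e : u j = -u i := by rw [he, neg_neg]
      simp only [e, PiLp.neg_apply] at hj
      rcases pos_and_pos_or_neg_and_neg_of_mul_pos hpos with ⟨h1, h2⟩ | ⟨h1, h2⟩
      · have := nonpos_of_mul_nonpos_right hi h1
        have := nonpos_of_mul_nonpos_right hj h2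
        linarith
      · have := nonneg_of_mul_nonpos_right hi h1
        have := nonneg_of_mul_nonpos_right hj h2
        linarith
    rcases eq_or_eq_neg_of_det_eq_zero (hu k) (hu i) hk with he' | he'
    · exact ⟨k, i, hki, he'⟩
    · exact ⟨k, j, hkj, by rw [he', he, neg_neg]⟩
  by_cases h01 : 0 < c 0 * c 1
  · exact key 0 1 2 (by decide) (by decide) (by decide) h01
  by_cases h02 : 0 < c 0 * c 2
  · exact key 0 2 1 (by decide) (by decide) (by decide) h02
  refine key 1 2 0 (by decide) (by decide) (by decide) ?_
  have hn1 : c 0 * c 1 < 0 := lt_of_le_of_ne (not_lt.1 h01) (mul_ne_zero (hc 0) (hc 1))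
  have hn2 : c 0 * c 2 < 0 := lt_of_le_of_ne (not_lt.1 h02) (mul_ne_zero (hc 0) (hc 2))
  have := mul_pos_of_neg_of_neg hn1 hn2
  have h00 : 0 < c 0 ^ 2 := by have := hc 0; positivity
  refine pos_of_mul_pos_right (a := c 0 ^ 2) ?_ h00.le
  linarith

theorem collinear_setOf_inner_eq {u : Plane} (hu : ‖u‖ = 1) (c : ℝ) :
    Collinear ℝ {x : Plane | ⟪u, x⟫ = c} := by
  rw [collinear_iff_exists_forall_eq_smul_vadd]
  refine ⟨c • u, !₂[-u 1, u 0], fun x hx => ⟨u 0 * x 1 - u 1 * x 0, ?_⟩⟩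
  have hsq := coord_sq_add_sq hu
  have hx' : u 0 * x 0 + u 1 * x 1 = c := by rw [← inner_eq_coord]; exact hx
  ext i
  fin_cases i
  · simp
    linear_combination u 0 * hx' - x 0 * hsq
  · simp
    linear_combination u 1 * hx' - x 1 * hsq

/-- The inner unit normals of the halfplanes bounded by a line through the endpoint `p` of `s`
that avoid `s` and all segments outside `H`, and whose boundary meets one of the latter. -/
def supportingNormals (S H : Set LineSegment) (s : LineSegment) (p : Plane) : Set Plane :=
  {u | ‖u‖ = 1 ∧ s.support u = ⟪u, p⟫ ∧ (∀ t ∈ S \ H, t.support u ≤ ⟪u, p⟫) ∧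
    ∃ t ∈ S \ H, t.support u = ⟪u, p⟫}

section

variable {S H : Set LineSegment}

theorem ne_of_mem_endpoints (hdisj : S.PairwiseDisjoint LineSegment.carrier)
    {s t : LineSegment} (hs : s ∈ S) (ht : t ∈ S) (hst : s ≠ t) {p q : Plane}
    (hp : p ∈ s.endpoints) (hq : q ∈ t.endpoints) : p ≠ q := by
  rintro rfl
  exact Set.disjoint_left.1 (hdisj hs ht hst) (s.endpoints_subset hp) (t.endpoints_subset hq)

theorem encard_supportingNormals_le (hdisj : S.PairwiseDisjoint LineSegment.carrier)
    (hHS : H ⊆ S) {s : LineSegment} (hs : s ∈ H) {p : Plane} (hp : p ∈ s.endpoints) :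
    (supportingNormals S H s p).encard ≤ 2 := by
  by_contra! hlt
  have h3 : (3 : ℕ∞) ≤ (supportingNormals S H s p).encard := by
    have := Order.add_one_le_of_lt hlt
    rwa [show (2 : ℕ∞) + 1 = 3 by norm_num] at this
  obtain ⟨T, hT, hT3⟩ := Set.exists_subset_encard_eq h3
  obtain ⟨a, b, d, hab, had, hbd, rfl⟩ := Set.encard_eq_three.1 hT3
  let u : Fin 3 → Plane := ![a, b, d]
  have hu : ∀ i, u i ∈ supportingNormals S H s p := by
    intro i
    fin_cases i
    · exact hT (by simp [u])
    · exact hT (by simp [u])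
    · exact hT (by simp [u])
  -- The cone at `p` is spanned by the vectors from `p` to endpoints `q i` at which the segments
  -- outside `H` touch the three lines.
  choose t ht htu using fun i => (hu i).2.2.2
  choose q hq hqu using fun i => (t i).exists_endpoint (u i)
  have hne : ∀ i, q i - p ≠ 0 := fun i => sub_ne_zero.2
    (ne_of_mem_endpoints hdisj (hHS hs) (ht i).1 (by rintro rfl; exact (ht i).2 hs) hp (hq i)).symm
  obtain ⟨i, j, hij, he⟩ := exists_eq_of_three_supporting (fun i => (hu i).1) hne
    (fun i => by rw [inner_sub_right, hqu, htu, sub_self])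
    (fun i j => by
      rw [inner_sub_right, sub_nonpos]
      exact ((t j).inner_le_support (hq j) _).trans ((hu i).2.2.1 _ (ht j)))
  fin_cases i <;> fin_cases j <;> simp [u] at hij he <;>
    first | exact hab he | exact had he | exact hbd he | exact hab he.symm | exact had he.symm |
      exact hbd he.symm

/-- A halfplane with `p` on its boundary is determined by its unit inner normal. As `s` lies outside
`H \ {s}`, the halfplane avoids `s` too, so `p` is extremal on `s`. -/
theorem inducedHalfplanes_subset_image {s : LineSegment} (hsS : s ∈ S) {p : Plane}
    (hp : p ∈ s.endpoints) :
    inducedHalfplanes S H s p ⊆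
      (fun u => {x : Plane | ⟪u, p⟫ < ⟪u, x⟫}) '' supportingNormals S H s p := by
  rintro h ⟨hph, t, ht, hh⟩
  obtain ⟨w, hw, c, rfl⟩ := hh.halfplane
  have hfr : ∀ y ∈ frontier {x : Plane | c < ⟪w, x⟫}, ⟪w, y⟫ = c := fun y hy =>
    (frontier_lt_subset_eq continuous_const (continuous_const.inner continuous_id) hy).symm
  have hpc := hfr p hph
  have hw0 : 0 < ‖w‖⁻¹ := inv_pos.2 (norm_pos_iff.2 hw)
  have havoid : ∀ r ∈ S \ (H \ {s}), r.support (‖w‖⁻¹ • w) ≤ ⟪‖w‖⁻¹ • w, p⟫ := by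
    intro r hr
    obtain ⟨y, hy, hyr⟩ := r.exists_endpoint (‖w‖⁻¹ • w)
    rw [← hyr, real_inner_smul_left, real_inner_smul_left, hpc]
    refine mul_le_mul_of_nonneg_left (not_lt.1 fun hlt => ?_) hw0.le
    exact Set.disjoint_left.1 (hh.avoids r hr) (r.endpoints_subset hy) hlt
  have hout : ∀ r ∈ S \ H, r ∈ S \ (H \ {s}) := fun r hr => ⟨hr.1, fun hr' => hr.2 hr'.1⟩
  refine ⟨‖w‖⁻¹ • w, ⟨?_, ?_, fun r hr => havoid r (hout r hr), t, ht, ?_⟩, ?_⟩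
  · rw [norm_smul, norm_inv, norm_norm, inv_mul_cancel₀ (norm_ne_zero_iff.2 hw)]
  · exact (havoid s ⟨hsS, fun hs => hs.2 rfl⟩).antisymm (s.inner_le_support hp _)
  · obtain ⟨q, hqt, hq⟩ := hh.right_boundary
    refine (havoid t (hout t ht)).antisymm ?_
    have := t.inner_le_support hqt (‖w‖⁻¹ • w)
    rwa [real_inner_smul_left, hfr q hq, ← hpc, ← real_inner_smul_left] at this
  · ext x
    simp only [Set.mem_ofPred_eq, real_inner_smul_left]
    rw [mul_lt_mul_iff_right₀ hw0, hpc]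

theorem encard_inducedHalfplanes_le (hdisj : S.PairwiseDisjoint LineSegment.carrier)
    (hHS : H ⊆ S) {s : LineSegment} (hs : s ∈ H) {p : Plane} (hp : p ∈ s.endpoints) :
    (inducedHalfplanes S H s p).encard ≤ 2 :=
  (Set.encard_le_encard (inducedHalfplanes_subset_image (hHS hs) hp)).trans
    ((Set.encard_image_le _ _).trans (encard_supportingNormals_le hdisj hHS hs hp))

/-! ### Regions and edges near infinity -/

theorem eq_of_inner_eq (hgp : GeneralPosition S) {u : Plane} (hu : ‖u‖ = 1) {p q r : Plane}
    (hp : p ∈ ⋃ s ∈ S, s.endpoints) (hq : q ∈ ⋃ s ∈ S, s.endpoints)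
    (hr : r ∈ ⋃ s ∈ S, s.endpoints) (hpq : ⟪u, p⟫ = ⟪u, q⟫) (hpr : ⟪u, p⟫ = ⟪u, r⟫) :
    p = q ∨ p = r ∨ q = r := by
  by_contra! h
  have hcol : Collinear ℝ {p, q, r} := by
    refine (collinear_setOf_inner_eq hu ⟪u, p⟫).subset ?_
    rintro x (rfl | rfl | rfl)
    exacts [rfl, hpq.symm, hpr.symm]
  have hle := hgp.line {p, q, r} (by rintro x (rfl | rfl | rfl) <;> assumption) hcol
  rw [Set.encard_eq_three.2 ⟨p, q, r, h.1, h.2.1, h.2.2, rfl⟩] at hle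
  exact absurd hle (by decide)

/-- In a direction in which `s` and `t` are extremal, no other segment is. -/
theorem eq_of_support_eq (hdisj : S.PairwiseDisjoint LineSegment.carrier)
    (hgp : GeneralPosition S) {u : Plane} (hu : ‖u‖ = 1) {s t r : LineSegment} (hs : s ∈ S)
    (ht : t ∈ S) (hr : r ∈ S) (hst : s ≠ t) (h : s.support u = t.support u)
    (hr' : s.support u = r.support u) : r = s ∨ r = t := by
  obtain ⟨p, hp, hpu⟩ := s.exists_endpoint u
  obtain ⟨q, hq, hqu⟩ := t.exists_endpoint u
  obtain ⟨y, hy, hyu⟩ := r.exists_endpoint u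
  by_contra! hne
  rcases eq_of_inner_eq hgp hu (Set.mem_biUnion hs hp) (Set.mem_biUnion ht hq)
    (Set.mem_biUnion hr hy) (by rw [hpu, hqu, h]) (by rw [hpu, hyu, hr']) with e | e | e
  · exact ne_of_mem_endpoints hdisj hs ht hst hp hq e
  · exact ne_of_mem_endpoints hdisj hs hr hne.1.symm hp hy e
  · exact ne_of_mem_endpoints hdisj ht hr hne.2.symm hq hy e

/-- The extremal endpoints of `s` and `t` already exhaust the two allowed on a line, so any other
endpoint of `s` lies strictly behind it. -/
theorem eventually_segDist_eq_of_support_eq (hdisj : S.PairwiseDisjoint LineSegment.carrier)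
    (hgp : GeneralPosition S) {u : Plane} (hu : ‖u‖ = 1) {s t : LineSegment} (hs : s ∈ S)
    (ht : t ∈ S) (hst : s ≠ t) (h : s.support u = t.support u) :
    ∃ p, ∀ᶠ x in atInfinity u, segDist x s = dist x p := by
  obtain ⟨p, hp, hpu⟩ := s.exists_endpoint u
  obtain ⟨q, hq, hqu⟩ := t.exists_endpoint u
  refine ⟨p, eventually_segDist_eq_dist hp fun r hr hrp => ?_⟩
  refine lt_of_le_of_ne (hpu ▸ s.inner_le_support hr u) fun he => ?_
  rcases eq_of_inner_eq hgp hu (Set.mem_biUnion hs hp) (Set.mem_biUnion ht hq)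
    (Set.mem_biUnion hs hr) (by rw [hpu, hqu, h]) he.symm with e | e | e
  · exact ne_of_mem_endpoints hdisj hs ht hst hp hq e
  · exact hrp e.symm
  · exact ne_of_mem_endpoints hdisj hs ht hst hr hq e.symm

theorem dist_lt_dist_iff_inner (x p q : Plane) :
    dist x p < dist x q ↔ 2 * ⟪q - p, x⟫ < ‖q‖ ^ 2 - ‖p‖ ^ 2 := by
  rw [← sq_lt_sq₀ dist_nonneg dist_nonneg, dist_eq_norm, dist_eq_norm, norm_sub_sq_real,
    norm_sub_sq_real, inner_sub_left, real_inner_comm x q, real_inner_comm x p]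
  constructor <;> intro h <;> linarith

theorem dist_eq_dist_iff_inner (x p q : Plane) :
    dist x p = dist x q ↔ 2 * ⟪q - p, x⟫ = ‖q‖ ^ 2 - ‖p‖ ^ 2 := by
  rw [← sq_eq_sq₀ dist_nonneg dist_nonneg, dist_eq_norm, dist_eq_norm, norm_sub_sq_real,
    norm_sub_sq_real, inner_sub_left, real_inner_comm x q, real_inner_comm x p]
  constructor <;> intro h <;> linarith

theorem isLinearMap_two_mul_inner (v : Plane) : IsLinearMap ℝ fun x : Plane => 2 * ⟪v, x⟫ :=
  ⟨fun x y => by rw [inner_add_right, mul_add],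
    fun c x => by rw [inner_smul_right, smul_eq_mul, mul_left_comm]⟩

theorem convex_setOf_dist_lt_dist (p q : Plane) : Convex ℝ {x : Plane | dist x p < dist x q} := by
  simp only [dist_lt_dist_iff_inner]
  exact convex_halfSpace_lt (isLinearMap_two_mul_inner _) _

theorem convex_setOf_dist_eq_dist (p q : Plane) : Convex ℝ {x : Plane | dist x p = dist x q} := by
  simp only [dist_eq_dist_iff_inner]
  exact convex_hyperplane (isLinearMap_two_mul_inner _) _

end

/-! ### Counting unbounded faces and edges -/

theorem subset_of_maximal_isConnected {X A D : Set Plane}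
    (hA : Maximal (fun A : Set Plane => A ⊆ X ∧ IsConnected A) A) (hD : IsPreconnected D)
    (hDX : D ⊆ X) (h : (A ∩ D).Nonempty) : D ⊆ A := by
  have hAD : IsConnected (A ∪ D) := ⟨hA.prop.2.nonempty.inl, hA.prop.2.isPreconnected.union' h hD⟩
  exact Set.subset_union_right.trans
    (hA.2 ⟨Set.union_subset hA.prop.1 hDX, hAD⟩ Set.subset_union_left)

theorem eq_of_maximal_isConnected {X A B D : Set Plane}
    (hA : Maximal (fun A : Set Plane => A ⊆ X ∧ IsConnected A) A)
    (hB : Maximal (fun A : Set Plane => A ⊆ X ∧ IsConnected A) B) (hD : IsPreconnected D)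
    (hDX : D ⊆ X) (hAD : (A ∩ D).Nonempty) (hBD : (B ∩ D).Nonempty) : A = B := by
  have key : ∀ {A B : Set Plane}, Maximal (fun A : Set Plane => A ⊆ X ∧ IsConnected A) A →
      Maximal (fun A : Set Plane => A ⊆ X ∧ IsConnected A) B →
      (A ∩ D).Nonempty → (B ∩ D).Nonempty → B ⊆ A := by
    intro A B hA hB hAD hBD
    have hDA := subset_of_maximal_isConnected hA hD hDX hAD
    exact subset_of_maximal_isConnected hA hB.prop.2.isPreconnected hB.prop.1
      (hBD.mono fun x hx => ⟨hDA hx.2, hx.1⟩)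
  exact (key hB hA hBD hAD).antisymm (key hA hB hAD hBD)

/-- Both components meet the convex set `X ∩ C`, which joins them inside `X`. -/
theorem eq_of_frequently_of_convex_inter {u : Plane} {X A B C : Set Plane}
    (hA : Maximal (fun A : Set Plane => A ⊆ X ∧ IsConnected A) A)
    (hB : Maximal (fun A : Set Plane => A ⊆ X ∧ IsConnected A) B)
    (hC : C ∈ atInfinity u) (hXC : Convex ℝ (X ∩ C)) (hAu : ∃ᶠ x in atInfinity u, x ∈ A)
    (hBu : ∃ᶠ x in atInfinity u, x ∈ B) : A = B := by
  refine eq_of_maximal_isConnected hA hB hXC.isPreconnected Set.inter_subset_left ?_ ?_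
  · obtain ⟨x, hx, hxC⟩ := (hAu.and_eventually hC).exists
    exact ⟨x, hx, hA.prop.1 hx, hxC⟩
  · obtain ⟨x, hx, hxC⟩ := (hBu.and_eventually hC).exists
    exact ⟨x, hx, hB.prop.1 hx, hxC⟩

variable {S H : Set LineSegment}

/-! ### Local shape of regions and edge loci near infinity -/

theorem isOpen_voronoiRegion (hS : S.Finite) (hHS : H ⊆ S) : IsOpen (voronoiRegion S H) := by
  have : voronoiRegion S H = ⋂ s ∈ H, ⋂ t ∈ S \ H, {x | segDist x s < segDist x t} := by
    ext x
    simp only [voronoiRegion, Set.mem_iInter, Set.mem_ofPred_eq]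
  rw [this]
  exact (hS.subset hHS).isOpen_biInter fun s _ => hS.sdiff.isOpen_biInter fun t _ =>
    isOpen_lt (continuous_segDist s) (continuous_segDist t)

/-- At a tie only `s` and `t` compete, and they act as two points: every other segment has strictly
larger or strictly smaller support. -/
theorem eventually_forall_of_support_eq (hS : S.Finite)
    (hdisj : S.PairwiseDisjoint LineSegment.carrier) (hgp : GeneralPosition S) (hHS : H ⊆ S)
    {u : Plane} (hu : ‖u‖ = 1) {s t : LineSegment} (hs : s ∈ H) (ht : t ∈ S \ H)
    (hst : s.support u = t.support u) (hin : ∀ s' ∈ H, s.support u ≤ s'.support u)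
    (hout : ∀ t' ∈ S \ H, t'.support u ≤ s.support u) :
    ∃ p q, ∀ᶠ x in atInfinity u, segDist x s = dist x p ∧ segDist x t = dist x q ∧
      (∀ s' ∈ H, s' ≠ s → segDist x s' < segDist x s ∧ segDist x s' < segDist x t) ∧
      ∀ t' ∈ S \ H, t' ≠ t → segDist x s < segDist x t' ∧ segDist x t < segDist x t' := by
  have hne : s ≠ t := by rintro rfl; exact ht.2 hs
  obtain ⟨p, hp⟩ :=
    eventually_segDist_eq_of_support_eq hdisj hgp hu (hHS hs) ht.1 hne hst
  obtain ⟨q, hq⟩ :=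
    eventually_segDist_eq_of_support_eq hdisj hgp hu ht.1 (hHS hs) hne.symm hst.symm
  refine ⟨p, q, ?_⟩
  have h1 : ∀ᶠ x in atInfinity u, ∀ s' ∈ H, s' ≠ s →
      segDist x s' < segDist x s ∧ segDist x s' < segDist x t := by
    refine (hS.subset hHS).eventually_all.2 fun s' hs' => ?_
    by_cases hss : s' = s
    · simp [hss]
    have hlt : s.support u < s'.support u := by
      refine lt_of_le_of_ne (hin s' hs') fun he => ?_
      rcases eq_of_support_eq hdisj hgp hu (hHS hs) ht.1 (hHS hs') hne hst he with rfl | rfl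
      exacts [hss rfl, ht.2 hs']
    filter_upwards [eventually_segDist_lt hlt, eventually_segDist_lt (hst ▸ hlt)] with x hx hx' _
    exact ⟨hx, hx'⟩
  have h2 : ∀ᶠ x in atInfinity u, ∀ t' ∈ S \ H, t' ≠ t →
      segDist x s < segDist x t' ∧ segDist x t < segDist x t' := by
    refine hS.sdiff.eventually_all.2 fun t' ht' => ?_
    by_cases htt : t' = t
    · simp [htt]
    have hlt : t'.support u < s.support u := by
      refine lt_of_le_of_ne (hout t' ht') fun he => ?_
      rcases eq_of_support_eq hdisj hgp hu (hHS hs) ht.1 ht'.1 hne hst he.symm with rfl | rfl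
      exacts [ht'.2 hs, htt rfl]
    filter_upwards [eventually_segDist_lt hlt, eventually_segDist_lt (hst ▸ hlt)] with x hx hx' _
    exact ⟨hx, hx'⟩
  filter_upwards [hp, hq, h1, h2] with x a b c d
  exact ⟨a, b, c, d⟩

theorem eventually_mem_voronoiRegion (hS : S.Finite) (hHS : H ⊆ S) {u : Plane}
    (h : ∀ s ∈ H, ∀ t ∈ S \ H, t.support u < s.support u) :
    voronoiRegion S H ∈ atInfinity u :=
  (hS.subset hHS).eventually_all.2 fun s hs => hS.sdiff.eventually_all.2 fun t ht =>
    eventually_segDist_lt (h s hs t ht)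

theorem support_le_of_frequently_mem_voronoiRegion {u : Plane}
    (h : ∃ᶠ x in atInfinity u, x ∈ voronoiRegion S H) {s t : LineSegment} (hs : s ∈ H)
    (ht : t ∈ S \ H) : t.support u ≤ s.support u :=
  support_le_of_frequently (h.mono fun _ hx => (hx s hs t ht).le)

theorem exists_convex_voronoiRegion_inter (hS : S.Finite)
    (hdisj : S.PairwiseDisjoint LineSegment.carrier) (hgp : GeneralPosition S) (hHS : H ⊆ S)
    {u : Plane} (hu : ‖u‖ = 1) (h : ∃ᶠ x in atInfinity u, x ∈ voronoiRegion S H) :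
    ∃ C ∈ atInfinity u, Convex ℝ (voronoiRegion S H ∩ C) := by
  have hle := fun s (hs : s ∈ H) t (ht : t ∈ S \ H) =>
    support_le_of_frequently_mem_voronoiRegion h hs ht
  by_cases hlt : ∀ s ∈ H, ∀ t ∈ S \ H, t.support u < s.support u
  · obtain ⟨C, hC, hconv, hCR⟩ :=
      exists_convex_of_eventually hu (eventually_mem_voronoiRegion hS hHS hlt)
    have hCR' : C ⊆ voronoiRegion S H := hCR
    exact ⟨C, hC, by rwa [Set.inter_eq_right.2 hCR']⟩
  push Not at hlt
  obtain ⟨s, hs, t, ht, hst⟩ := hlt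
  have hst' := hst.antisymm (hle s hs t ht)
  obtain ⟨p, q, hpq⟩ := eventually_forall_of_support_eq hS hdisj hgp hHS hu hs ht hst'
    (fun s' hs' => hst'.trans_le (hle s' hs' t ht)) (fun t' ht' => hle s hs t' ht')
  obtain ⟨C, hC, hconv, hCP⟩ := exists_convex_of_eventually hu hpq
  refine ⟨C, hC, ?_⟩
  -- Near `u` all defining inequalities but the one between `s` and `t` hold automatically.
  have : voronoiRegion S H ∩ C = {x | dist x p < dist x q} ∩ C := by
    ext x
    refine and_congr_left fun hx => ?_
    obtain ⟨hp, hq, h1, h2⟩ := hCP x hx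
    refine ⟨fun hxR => ?_, fun hxp s' hs' t' ht' => ?_⟩
    · have := hxR s hs t ht
      rwa [hp, hq] at this
    · have hxp' : segDist x s < segDist x t := by rw [hp, hq]; exact hxp
      by_cases hss : s' = s
      · subst hss
        by_cases htt : t' = t
        · rwa [htt]
        · exact (h2 t' ht' htt).1
      · by_cases htt : t' = t
        · rw [htt]
          exact (h1 s' hs' hss).2
        · exact (h1 s' hs' hss).1.trans (h2 t' ht' htt).1
  rw [this]
  exact (convex_setOf_dist_lt_dist p q).inter hconv

theorem exists_convex_edgeLocus_inter (hS : S.Finite)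
    (hdisj : S.PairwiseDisjoint LineSegment.carrier) (hgp : GeneralPosition S) (hHS : H ⊆ S)
    {u : Plane} (hu : ‖u‖ = 1) {s t : LineSegment} (hs : s ∈ H) (ht : t ∈ S \ H)
    (hst : s.support u = t.support u) (hin : ∀ s' ∈ H, s.support u ≤ s'.support u)
    (hout : ∀ t' ∈ S \ H, t'.support u ≤ s.support u) :
    ∃ C ∈ atInfinity u, Convex ℝ (edgeLocus S (H \ {s}) s t ∩ C) := by
  obtain ⟨p, q, hpq⟩ :=
    eventually_forall_of_support_eq hS hdisj hgp hHS hu hs ht hst hin hout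
  obtain ⟨C, hC, hconv, hCP⟩ := exists_convex_of_eventually hu hpq
  refine ⟨C, hC, ?_⟩
  have : edgeLocus S (H \ {s}) s t ∩ C = {x | dist x p = dist x q} ∩ C := by
    ext x
    refine and_congr_left fun hx => ?_
    obtain ⟨hp, hq, h1, h2⟩ := hCP x hx
    refine ⟨fun hxE => ?_, fun hxp => ⟨?_, fun s' hs' => (h1 s' hs'.1 hs'.2).1, ?_⟩⟩
    · have := hxE.1
      rwa [hp, hq] at this
    · rw [hp, hq]
      exact hxp
    · rintro t' ⟨ht'S, ht'⟩
      simp only [Set.mem_union, Set.mem_sdiff, Set.mem_singleton_iff, Set.mem_insert_iff,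
        not_or, not_and, not_not] at ht'
      exact (h2 t' ⟨ht'S, fun h => ht'.2.1 (ht'.1 h)⟩ ht'.2.2).1
  rw [this]
  exact (convex_setOf_dist_eq_dist p q).inter hconv

/-- Along an unbounded edge, the supporting lines of `s` and `t` agree in the limit. -/
theorem support_of_frequently_mem_edgeLocus {u : Plane} {s t : LineSegment}
    (h : ∃ᶠ x in atInfinity u, x ∈ edgeLocus S (H \ {s}) s t) :
    s.support u = t.support u ∧ (∀ s' ∈ H, s.support u ≤ s'.support u) ∧
      ∀ t' ∈ S \ H, t'.support u ≤ s.support u := by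
  have hst : s.support u = t.support u :=
    (support_le_of_frequently (h.mono fun _ hx => hx.1.ge)).antisymm
      (support_le_of_frequently (h.mono fun _ hx => hx.1.le))
  refine ⟨hst, fun s' hs' => ?_, fun t' ht' => ?_⟩
  · by_cases hss : s' = s
    · rw [hss]
    · exact support_le_of_frequently (h.mono fun x hx => (hx.2.1 s' ⟨hs', hss⟩).le)
  · by_cases htt : t' = t
    · rw [htt, hst]
    by_cases hts : t' = s
    · rw [hts]
    refine support_le_of_frequently (h.mono fun x hx => (hx.2.2 t' ⟨ht'.1, ?_⟩).le)
    rintro (h' | h' | h')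
    exacts [ht'.2 h'.1, hts h', htt h']

/-! ### Charging unbounded edges and faces to supporting normals -/

theorem encard_inducedUnboundedEdges_le (hS : S.Finite)
    (hdisj : S.PairwiseDisjoint LineSegment.carrier) (hgp : GeneralPosition S) (hHS : H ⊆ S)
    {s : LineSegment} (hs : s ∈ H) {p : Plane} (hp : p ∈ s.endpoints) :
    (inducedUnboundedEdges S H s p).encard ≤ 2 := by
  have hex : ∀ E ∈ inducedUnboundedEdges S H s p, ∃ u, ‖u‖ = 1 ∧
      ∃ᶠ x in atInfinity u, x ∈ E ∧ dist x p = segDist x s := fun E hE => exists_direction hE.2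
  choose! u hu hfreq using hex
  have hnormal : Set.MapsTo u (inducedUnboundedEdges S H s p) (supportingNormals S H s p) := by
    intro E hE
    obtain ⟨t, ht, hEt⟩ := hE.1
    obtain ⟨hst, -, hout⟩ :=
      support_of_frequently_mem_edgeLocus ((hfreq E hE).mono fun x hx => hEt.prop.1 hx.1)
    have hsp := support_eq_of_frequently hp ((hfreq E hE).mono fun x hx => hx.2)
    exact ⟨hu E hE, hsp, fun t' ht' => hsp ▸ hout t' ht', t, ht, hst ▸ hsp⟩
  refine (Set.encard_le_encard_of_injOn hnormal fun E hE E' hE' he => ?_).trans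
    (encard_supportingNormals_le hdisj hHS hs hp)
  obtain ⟨t, ht, hEt⟩ := hE.1
  obtain ⟨t', ht', hEt'⟩ := hE'.1
  have hfE := (hfreq E hE).mono fun x hx => hx.1
  have hfE' := (hfreq E' hE').mono fun x hx => hx.1
  rw [← he] at hfE'
  obtain ⟨hst, hin, hout⟩ :=
    support_of_frequently_mem_edgeLocus (hfE.mono fun x hx => hEt.prop.1 hx)
  obtain ⟨hst', -⟩ := support_of_frequently_mem_edgeLocus (hfE'.mono fun x hx => hEt'.prop.1 hx)
  -- Two edges with the same limit direction involve the same `t`, since a third extremal segment is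
  -- excluded.
  have htt : t' = t := by
    rcases eq_of_support_eq hdisj hgp (hu E hE) (hHS hs) ht.1 ht'.1
      (by rintro rfl; exact ht.2 hs) hst hst' with rfl | h
    exacts [absurd hs ht'.2, h]
  subst htt
  obtain ⟨C, hC, hconv⟩ :=
    exists_convex_edgeLocus_inter hS hdisj hgp hHS (hu E hE) hs ht hst hin hout
  exact eq_of_frequently_of_convex_inter hEt hEt' hC hconv hfE hfE'

theorem eq_of_isFace_of_frequently (hS : S.Finite)
    (hdisj : S.PairwiseDisjoint LineSegment.carrier) (hgp : GeneralPosition S) (hHS : H ⊆ S)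
    {F F' : Set Plane} (hF : IsFace (voronoiRegion S H) F) (hF' : IsFace (voronoiRegion S H) F')
    {u : Plane} (hu : ‖u‖ = 1) (hFu : ∃ᶠ x in atInfinity u, x ∈ F)
    (hFu' : ∃ᶠ x in atInfinity u, x ∈ F') : F = F' := by
  rw [IsFace, (isOpen_voronoiRegion hS hHS).interior_eq] at hF hF'
  obtain ⟨C, hC, hconv⟩ := exists_convex_voronoiRegion_inter hS hdisj hgp hHS hu
    (hFu.mono fun x hx => hF.prop.1 hx)
  exact eq_of_frequently_of_convex_inter hF hF' hC hconv hFu hFu'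

/-- The normals of all supporting halfplanes induced by endpoints of segments of `H`. -/
def allSupportingNormals (S H : Set LineSegment) : Set Plane :=
  ⋃ s ∈ H, ⋃ p ∈ s.endpoints, supportingNormals S H s p

theorem encard_biUnion_le_mul {α β : Type*} {A : Set α} (hA : A.Finite) (f : α → Set β) (n : ℕ∞)
    (h : ∀ a ∈ A, (f a).encard ≤ n) : (⋃ a ∈ A, f a).encard ≤ n * A.encard := by
  induction A, hA using Set.Finite.induction_on with
  | empty => simp
  | @insert a A ha _ ih =>
    rw [Set.biUnion_insert, Set.encard_insert_of_notMem ha, mul_add, mul_one, add_comm (n * _)]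
    exact (Set.encard_union_le _ _).trans (add_le_add (h a (Set.mem_insert _ _))
      (ih fun b hb => h b (Set.mem_insert_of_mem _ hb)))

theorem encard_allSupportingNormals_le (hS : S.Finite)
    (hdisj : S.PairwiseDisjoint LineSegment.carrier) (hHS : H ⊆ S) :
    (allSupportingNormals S H).encard ≤ 4 * H.encard := by
  refine encard_biUnion_le_mul (hS.subset hHS) _ 4 fun s hs => ?_
  have hfin : s.endpoints.Finite := Set.toFinite {s.left, s.right}
  refine (encard_biUnion_le_mul hfin _ 2
    fun p hp => encard_supportingNormals_le hdisj hHS hs hp).trans ?_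
  calc 2 * s.endpoints.encard ≤ 2 * 2 := mul_le_mul_right ((Set.encard_insert_le _ _).trans_eq (by
      rw [Set.encard_singleton]; norm_num)) 2
    _ = 4 := by norm_num

theorem mem_atInfinity_of_isFace (hS : S.Finite) (hHS : H ⊆ S) {F : Set Plane}
    (hF : IsFace (voronoiRegion S H) F) {u : Plane} (hu : ‖u‖ = 1)
    (hFu : ∃ᶠ x in atInfinity u, x ∈ F) (hn : u ∉ allSupportingNormals S H) :
    F ∈ atInfinity u := by
  rw [IsFace, (isOpen_voronoiRegion hS hHS).interior_eq] at hF
  have hle := fun s (hs : s ∈ H) t (ht : t ∈ S \ H) =>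
    support_le_of_frequently_mem_voronoiRegion (hFu.mono fun x hx => hF.prop.1 hx) hs ht
  have hlt : ∀ s ∈ H, ∀ t ∈ S \ H, t.support u < s.support u := by
    intro s hs t ht
    refine lt_of_le_of_ne (hle s hs t ht) fun he => hn ?_
    obtain ⟨p, hp, hpu⟩ := s.exists_endpoint u
    exact Set.mem_biUnion hs (Set.mem_biUnion hp
      ⟨hu, hpu.symm, fun t' ht' => hpu ▸ hle s hs t' ht', t, ht, by rw [he, hpu]⟩)
  obtain ⟨C, hC, hconv, hCR⟩ :=
    exists_convex_of_eventually hu (eventually_mem_voronoiRegion hS hHS hlt)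
  exact mem_of_superset hC
    (subset_of_maximal_isConnected hF hconv.isPreconnected hCR (hFu.and_eventually hC).exists)

/-- Away from the normals, accumulating in a direction and filling a neighbourhood of it coincide.
The first condition is closed in the direction, the second open, and the unit circle is connected.
-/
theorem mem_atInfinity_of_forall_notMem (hS : S.Finite) (hHS : H ⊆ S) {F : Set Plane}
    (hF : IsFace (voronoiRegion S H) F) (hFb : ¬ IsBounded F)
    (hn : ∀ u ∈ allSupportingNormals S H, ‖u‖ = 1 → ¬ ∃ᶠ x in atInfinity u, x ∈ F) {u : Plane}
    (hu : ‖u‖ = 1) : F ∈ atInfinity u := by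
  have hmem : ∀ v : Plane, ‖v‖ = 1 → (∃ᶠ x in atInfinity v, x ∈ F) → F ∈ atInfinity v :=
    fun v hv hFv => mem_atInfinity_of_isFace hS hHS hF hv hFv fun h => hn v h hv hFv
  have hrank : 1 < Module.rank ℝ Plane := by
    rw [← Module.finrank_eq_rank]
    simp
  have hopen : IsOpen {v : Plane | F ∈ atInfinity v} :=
    isOpen_iff_mem_nhds.2 fun v hv => eventually_atInfinity_nhds hv
  by_contra hnot
  obtain ⟨v, hv, hFv⟩ := exists_direction hFb
  obtain ⟨w, hw, hwF, hwF'⟩ := isPreconnected_sphere hrank (0 : Plane) 1 _ _ hopen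
    (isClosed_setOf_frequently_atInfinity F).isOpen_compl
    (fun w hw => by
      by_cases hwF : ∃ᶠ x in atInfinity w, x ∈ F
      · exact Or.inl (hmem w (by simpa using hw) hwF)
      · exact Or.inr hwF)
    ⟨v, by simpa using hv, hmem v hv hFv⟩ ⟨u, by simpa using hu, fun h => hnot (hmem u hu h)⟩
  have := atInfinity_neBot (show ‖w‖ = 1 by simpa using hw)
  exact hwF' (Eventually.frequently hwF)

theorem encard_unboundedFaces_le (hS : S.Finite)
    (hdisj : S.PairwiseDisjoint LineSegment.carrier) (hgp : GeneralPosition S) (hHS : H ⊆ S)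
    (hH : H.Nonempty) :
    {F : Set Plane | IsFace (voronoiRegion S H) F ∧ ¬ IsBounded F}.encard ≤ 4 * H.encard := by
  by_cases h : ∀ F, IsFace (voronoiRegion S H) F → ¬ IsBounded F →
      ∃ u ∈ allSupportingNormals S H, ‖u‖ = 1 ∧ ∃ᶠ x in atInfinity u, x ∈ F
  · choose! u hu hu1 hFu using h
    refine (Set.encard_le_encard_of_injOn (fun F hF => hu F hF.1 hF.2)
      fun F hF F' hF' he => ?_).trans (encard_allSupportingNormals_le hS hdisj hHS)
    exact eq_of_isFace_of_frequently hS hdisj hgp hHS hF.1 hF'.1 (hu1 F hF.1 hF.2)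
      (hFu F hF.1 hF.2) (he ▸ hFu F' hF'.1 hF'.2)
  · push Not at h
    obtain ⟨F, hF, hFb, hn⟩ := h
    -- `F` fills every direction, so any unbounded face shares a limit direction with `F` and equals
    -- it.
    have h1 : {F : Set Plane | IsFace (voronoiRegion S H) F ∧ ¬ IsBounded F}.encard ≤ 1 := by
      have hall : ∀ G, IsFace (voronoiRegion S H) G → ¬ IsBounded G → G = F := by
        intro G hG hGb
        obtain ⟨u, hu, hGu⟩ := exists_direction hGb
        have := atInfinity_neBot hu
        have hFu := mem_atInfinity_of_forall_notMem hS hHS hF hFb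
          (fun v hv hv1 hfr => hfr (hn v hv hv1)) hu
        exact eq_of_isFace_of_frequently hS hdisj hgp hHS hG hF hu hGu (Eventually.frequently hFu)
      exact Set.encard_le_one_iff.2 fun A B hA hB =>
        (hall A hA.1 hA.2).trans (hall B hB.1 hB.2).symm
    refine h1.trans ?_
    calc (1 : ℕ∞) ≤ 4 * 1 := by norm_num
      _ ≤ 4 * H.encard := mul_le_mul_right (Set.one_le_encard_iff_nonempty.2 hH) 4

end SegmentVoronoi

theorem mainTheorem10 :
    ∃ C : ℕ, ∀ (S H : Set SegmentVoronoi.LineSegment) (k : ℕ),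
      S.Finite →
      S.PairwiseDisjoint SegmentVoronoi.LineSegment.carrier →
      SegmentVoronoi.GeneralPosition S →
      H ⊆ S → H.encard = k → 1 ≤ k →
      {F : Set SegmentVoronoi.Plane |
          SegmentVoronoi.IsFace (SegmentVoronoi.voronoiRegion S H) F ∧
            ¬ Bornology.IsBounded F}.encard ≤ C * k ∧
      ∀ s ∈ H, ∀ p ∈ s.endpoints,
        (SegmentVoronoi.inducedHalfplanes S H s p).encard ≤ 2 ∧
        (SegmentVoronoi.inducedUnboundedEdges S H s p).encard ≤ 2 := by
  -- 4 is two endpoints per segment times two normals per endpoint.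
  refine ⟨4, fun S H k hS hdisj hgp hHS hk hk1 => ⟨?_, fun s hs p hp => ⟨?_, ?_⟩⟩⟩
  · have hH : H.Nonempty := by
      rw [← Set.one_le_encard_iff_nonempty, hk]
      exact_mod_cast hk1
    have := SegmentVoronoi.encard_unboundedFaces_le hS hdisj hgp hHS hH
    rw [hk] at this
    exact_mod_cast this
  · exact SegmentVoronoi.encard_inducedHalfplanes_le hdisj hHS hs hp
  · exact SegmentVoronoi.encard_inducedUnboundedEdges_le hS hdisj hgp hHS hs hp
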